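/- Let $V$ be a finite set and let $C\in\mathbb{R}^{V\times V}$ be a diagonal positive definite matrix (for instance $C=2I$). A \emph{DAG} on $V$ is a directed graph $\mathcal{G}=(V,E)$ that contains every self-loop $i\to i$ and has no directed cycle of length greater than one; a \emph{polytree} is a DAG whose skeleton (the undirected graph obtained by dropping self-loops and forgetting edge directions) is a tree. A real matrix is \emph{stable} if all its eigenvalues have strictly negative real part. The \emph{Lyapunov model} of $\mathcal{G}$ is the set $\mathcal{M}_{\mathcal{G},C}$ of all positive definite matrices $\Sigma\in\mathbb{R}^{V\times V}$ for which there is a stable matrix $M$ with $m_{ji}=0$ whenever $i\to j\notin E$ and $M\Sigma+\Sigma M^{T}+C=0$. A DAG $\mathcal{G}$ on $V$ is \emph{structurally identifiable within the class of Lyapunov DAG models} if the only DAG $\mathcal{H}$ on $V$ with $\mathcal{M}_{\mathcal{H},C}=\mathcal{M}_{\mathcal{G},C}$ is $\mathcal{G}$ itself. Write $\mathrm{pa}(i)$, $\mathrm{ch}(i)$ for the parents and children of $i$ (ignoring self-loops) and $\mathrm{ne}(i)=\mathrm{pa}(i)\cup\mathrm{ch}(i)$. An edge $i\to j$ with $i\neq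 j$ of a DAG $\mathcal{G}$ is \emph{super-covered} if 1. $\mathrm{ch}(i)=\mathrm{ch}(j)\cup\{j\}$ and $\mathrm{pa}(i)\cup\{i\}=\mathrm{pa}(j)$; 2. $k\to l\in E$ for all $k\in\mathrm{pa}(j)$ and $l\in\mathrm{ch}(i)$; 3. every $k\in V\setminus\{i,j\}$ lies in $\mathrm{ne}(i)\cap\mathrm{ne}(j)$ or is marginally independent of $\{i,j\}$ in the model, i.e. $\sigma_{ki}=\sigma_{kj}=0$ for all $\Sigma\in\mathcal{M}_{\mathcal{G},C}$. \textbf{Corollary.} Let $\mathcal{T}$ be a polytree on $V$ with $|V|\ge 3$. Then $\mathcal{T}$ is structurally identifiable within the class of Lyapunov DAG models. Moreover, $\mathcal{T}$ contains no super-covered edge. -/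

import Mathlib

namespace LyapunovModel

open Matrix

variable {V : Type*}

/-- A real square matrix is stable if all its (complex) eigenvalues have strictly negative
real part. -/
def IsStable [Fintype V] [DecidableEq V] (M : Matrix V V ℝ) : Prop :=
  ∀ z ∈ spectrum ℂ (M.map (algebraMap ℝ ℂ)), z.re < 0

/-- The space of drift matrices supported on the edges of `G`: the entry in row `j` and column
`i` may be nonzero only if `i → j` is an edge. -/
def driftSpace (G : Digraph V) : Set (Matrix V V ℝ) :=
  {M | ∀ i j, ¬ G.Adj i j → M j i = 0}

/-- The graphical continuous Lyapunov model of `G` with volatility matrix `C`. A centered normal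
distribution is represented by its covariance matrix `S`. -/
def model [Fintype V] [DecidableEq V] (C : Matrix V V ℝ) (G : Digraph V) :
    Set (Matrix V V ℝ) :=
  {S | S.PosDef ∧ ∃ M ∈ driftSpace G, IsStable M ∧ M * S + S * Mᵀ + C = 0}

/-- `G₁` and `G₂` are model equivalent (for the volatility matrix `C`). -/
def ModelEquivalent [Fintype V] [DecidableEq V] (C : Matrix V V ℝ) (G₁ G₂ : Digraph V) : Prop :=
  model C G₁ = model C G₂

/-- `G` belongs to the class `L`, and its model equivalence class meets `L` in exactly one
element. -/
def StructurallyIdentifiable [Fintype V] [DecidableEq V] (C : Matrix V V ℝ)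
    (L : Set (Digraph V)) (G : Digraph V) : Prop :=
  G ∈ L ∧ ∃! H : Digraph V, H ∈ L ∧ ModelEquivalent C G H

/-- Parents of `i`; self-loops are ignored. -/
def parents (G : Digraph V) (i : V) : Set V := {k | k ≠ i ∧ G.Adj k i}

/-- Children of `i`; self-loops are ignored. -/
def children (G : Digraph V) (i : V) : Set V := {k | k ≠ i ∧ G.Adj i k}

/-- Neighbors of `i`; self-loops are ignored. -/
def neighbors (G : Digraph V) (i : V) : Set V := parents G i ∪ children G i

/-- The DAGs on the vertex set `V`: directed graphs that contain every self-loop and have no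
directed cycle of length greater than one (that is, no nonempty closed directed walk along
edges which are not self-loops). -/
def dags (V : Type*) : Set (Digraph V) :=
  {G | (∀ i, G.Adj i i) ∧ ∀ i, ¬ Relation.TransGen (fun a b => a ≠ b ∧ G.Adj a b) i i}

/-- A polytree: a DAG whose skeleton is a tree. -/
def IsPolytree (G : Digraph V) : Prop :=
  G ∈ dags V ∧ G.toSimpleGraphInclusive.IsTree

/-- The marginal independence of `k` and `{i, j}` holds in the model of `G`. For jointly normal
variables this is the vanishing of the two covariances. -/
def MarginallyIndependent [Fintype V] [DecidableEq V] (C : Matrix V V ℝ) (G : Digraph V)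
    (k i j : V) : Prop :=
  ∀ S ∈ model C G, S k i = 0 ∧ S k j = 0

/-- The edge `i → j` of `G` is super-covered. -/
structure IsSuperCovered [Fintype V] [DecidableEq V] (C : Matrix V V ℝ) (G : Digraph V)
    (i j : V) : Prop where
  ne : i ≠ j
  adj : G.Adj i j
  children_eq : children G i = children G j ∪ {j}
  parents_eq : parents G i ∪ {i} = parents G j
  complete : ∀ k ∈ parents G j, ∀ l ∈ children G i, G.Adj k l
  others : ∀ k, k ≠ i → k ≠ j →
    k ∈ neighbors G i ∩ neighbors G j ∨ MarginallyIndependent C G k i j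

end LyapunovModel

namespace LyapunovModel

open Matrix

/-! The model is shown to remember the skeleton and, for polytrees with at least three vertices,
every orientation. Diagonal rescaling reduces to `C = 1`, and stability is automatic once `S` and
`C` are positive definite, so membership in a model is a linear feasibility problem in the drift
matrix.

Padding a small covariance matrix by an identity block tests membership only on the induced subgraph
(`extend_mem_model_iff`). Explicit 2×2 and 3×3 matrices then suffice: two nodes detect adjacency. On
a path `a - b - c` with nonadjacent ends, one chain matrix excludes the reversed chain, the fork and
the collider, and one fork matrix excludes the collider. Hence equal models orient such paths
identically (`adj_of_model_eq_of_path`).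

In a tree on at least three vertices, each edge lies on such a path, so all orientations are
determined. The third vertex of that path also violates the last condition for a super-covered edge:
it is adjacent to exactly one endpoint, and adjacent variables are correlated somewhere in the
model. -/

/-! ### Stability is automatic -/

/-- A solution of the Lyapunov equation with positive definite `S` and `C` is stable. -/
lemma isStable_of_lyapunov {V : Type*} [Fintype V] [DecidableEq V] {M S C : Matrix V V ℝ}
    (hS : S.PosDef) (hC : C.PosDef) (h : M * S + S * Mᵀ + C = 0) : IsStable M := by
  intro z hz
  -- Transposing yields a left eigenvector of `M`, the kind that pairs with the Lyapunov equation as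
  -- a quadratic form.
  have hz' : ((algebraMap ℂ (Matrix V V ℂ) z - M.map (algebraMap ℝ ℂ))ᵀ).det = 0 := by
    rw [det_transpose]
    by_contra hne
    exact hz ((Matrix.isUnit_iff_isUnit_det _).2 (isUnit_iff_ne_zero.2 hne))
  obtain ⟨v, hv0, hv⟩ := exists_mulVec_eq_zero_iff.2 hz'
  set x : V → ℝ := fun i => (v i).re with hx
  set y : V → ℝ := fun i => (v i).im with hy
  have hv2 : ∀ i, ∑ j, (M j i : ℂ) * v j = z * v i := by
    intro i
    have := congrFun hv i
    rw [transpose_sub, sub_mulVec, Pi.sub_apply, Pi.zero_apply, sub_eq_zero] at this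
    rw [algebraMap_eq_diagonal, diagonal_transpose, mulVec_diagonal] at this
    simpa [mulVec, dotProduct] using this.symm
  have hMx : Mᵀ *ᵥ x = z.re • x - z.im • y := by
    ext i
    have := congrArg Complex.re (hv2 i)
    simpa [mulVec, dotProduct, hx, hy] using this
  have hMy : Mᵀ *ᵥ y = z.re • y + z.im • x := by
    ext i
    have := congrArg Complex.im (hv2 i)
    simpa [mulVec, dotProduct, hx, hy] using this
  have hsymm : ∀ u w : V → ℝ, u ⬝ᵥ (S *ᵥ w) = w ⬝ᵥ (S *ᵥ u) := by
    intro u w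
    have hST : Sᵀ = S := by simpa using hS.isHermitian.eq
    rw [dotProduct_mulVec, ← mulVec_transpose, hST, dotProduct_comm]
  have key : ∀ u : V → ℝ, 2 * (u ⬝ᵥ (S *ᵥ (Mᵀ *ᵥ u))) + u ⬝ᵥ (C *ᵥ u) = 0 := by
    intro u
    have h1 : u ⬝ᵥ ((M * S + S * Mᵀ + C) *ᵥ u) = 0 := by simp [h]
    rw [add_mulVec, add_mulVec, dotProduct_add, dotProduct_add, ← mulVec_mulVec,
      ← mulVec_mulVec, dotProduct_mulVec u M, ← mulVec_transpose, hsymm (Mᵀ *ᵥ u) u] at h1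
    linarith
  have kx := key x
  have ky := key y
  rw [hMx, mulVec_sub, mulVec_smul, mulVec_smul, dotProduct_sub, dotProduct_smul,
    dotProduct_smul, smul_eq_mul, smul_eq_mul] at kx
  rw [hMy, mulVec_add, mulVec_smul, mulVec_smul, dotProduct_add, dotProduct_smul,
    dotProduct_smul, smul_eq_mul, smul_eq_mul, hsymm y x] at ky
  have hxy : x ≠ 0 ∨ y ≠ 0 := by
    by_contra! hcon
    exact hv0 (funext fun i => Complex.ext (congrFun hcon.1 i) (congrFun hcon.2 i))
  have nonneg : ∀ {A : Matrix V V ℝ}, A.PosDef → ∀ u, 0 ≤ u ⬝ᵥ (A *ᵥ u) := fun hA u => by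
    simpa using hA.posSemidef.dotProduct_mulVec_nonneg u
  have pos : ∀ {A : Matrix V V ℝ}, A.PosDef → ∀ u, u ≠ 0 → 0 < u ⬝ᵥ (A *ᵥ u) :=
    fun hA u hu => by simpa using hA.dotProduct_mulVec_pos hu
  have sum_pos : ∀ {A : Matrix V V ℝ}, A.PosDef → 0 < x ⬝ᵥ (A *ᵥ x) + y ⬝ᵥ (A *ᵥ y) := by
    intro A hA
    rcases hxy with h0 | h0
    · exact add_pos_of_pos_of_nonneg (pos hA _ h0) (nonneg hA _)
    · exact add_pos_of_nonneg_of_pos (nonneg hA _) (pos hA _ h0)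
  have h1 := sum_pos hS
  have h2 := sum_pos hC
  by_contra! hre
  -- In the sum of `kx` and `ky` the cross terms cancel, leaving `2 * z.re` times the form of `S`
  -- plus the form of `C`, both positive.
  nlinarith [mul_nonneg hre h1.le]

lemma mem_model_iff {V : Type*} [Fintype V] [DecidableEq V] {C S : Matrix V V ℝ}
    (hC : C.PosDef) {G : Digraph V} :
    S ∈ model C G ↔ S.PosDef ∧ ∃ M ∈ driftSpace G, M * S + S * Mᵀ + C = 0 :=
  ⟨fun ⟨hS, M, hM, _, h⟩ => ⟨hS, M, hM, h⟩,
    fun ⟨hS, M, hM, h⟩ => ⟨hS, M, hM, isStable_of_lyapunov hS hC h, h⟩⟩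

/-! ### Reduction to the identity volatility matrix -/

/-- Rescaling of the variables. -/
lemma rescale_mem_model {V : Type*} [Fintype V] [DecidableEq V] {C S : Matrix V V ℝ}
    {d e : V → ℝ} (hd : ∀ i, d i * e i = 1)
    (hC' : (diagonal d * C * diagonal d).PosDef) {G : Digraph V} (hS : S ∈ model C G) :
    diagonal d * S * diagonal d ∈ model (diagonal d * C * diagonal d) G := by
  obtain ⟨hS, M, hM, _, h⟩ := hS
  have hed : diagonal e * diagonal d = (1 : Matrix V V ℝ) := by
    rw [diagonal_mul_diagonal, ← diagonal_one]
    exact congrArg _ (funext fun i => by rw [mul_comm, hd])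
  have hde : diagonal d * diagonal e = (1 : Matrix V V ℝ) := by
    rw [diagonal_mul_diagonal, ← diagonal_one]
    exact congrArg _ (funext fun i => hd i)
  refine (mem_model_iff hC').2 ⟨?_, diagonal d * M * diagonal e, ?_, ?_⟩
  · have := hS.mul_mul_conjTranspose_same (B := diagonal d) (by
      intro u v huv
      have := congrArg (fun w => w ᵥ* diagonal e) huv
      simpa [vecMul_vecMul, hde] using this)
    simpa using this
  · intro i j hij
    rw [mul_diagonal, diagonal_mul, hM i j hij]
    simp
  · have e1 : diagonal d * M * diagonal e * (diagonal d * S * diagonal d)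
        = diagonal d * (M * S) * diagonal d := by
      calc _ = diagonal d * M * (diagonal e * diagonal d) * S * diagonal d := by
              simp only [Matrix.mul_assoc]
        _ = _ := by rw [hed]; simp only [Matrix.mul_assoc, Matrix.one_mul]
    have e2 : diagonal d * S * diagonal d * (diagonal d * M * diagonal e)ᵀ
        = diagonal d * (S * Mᵀ) * diagonal d := by
      rw [transpose_mul, transpose_mul, diagonal_transpose, diagonal_transpose]
      calc _ = diagonal d * S * (diagonal d * diagonal e) * Mᵀ * diagonal d := by
              simp only [Matrix.mul_assoc]
        _ = _ := by rw [hde]; simp only [Matrix.mul_assoc, Matrix.one_mul]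
    rw [e1, e2, ← Matrix.add_mul, ← Matrix.mul_add, ← Matrix.add_mul, ← Matrix.mul_add, h]
    simp

/-- A diagonal positive definite volatility matrix can be normalized to the identity. -/
lemma exists_rescaling {V : Type*} [Fintype V] [DecidableEq V] {C : Matrix V V ℝ}
    (hC : C.PosDef) (hdiag : C.IsDiag) : ∃ d e : V → ℝ, (∀ i, d i * e i = 1) ∧
      diagonal d * C * diagonal d = 1 ∧ diagonal e * 1 * diagonal e = C := by
  have hpos : ∀ i, 0 < C i i := fun i => hC.diag_pos
  refine ⟨fun i => (√(C i i))⁻¹, fun i => √(C i i), fun i => ?_, ?_, ?_⟩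
  · exact inv_mul_cancel₀ (Real.sqrt_pos.2 (hpos i)).ne'
  · ext i j
    rw [mul_diagonal, diagonal_mul]
    rcases eq_or_ne i j with rfl | hij
    · have := Real.mul_self_sqrt (hpos i).le
      have h0 := (Real.sqrt_pos.2 (hpos i)).ne'
      rw [one_apply_eq]
      field_simp
      rw [sq, this]
    · simp [hdiag hij, one_apply_ne hij]
  · ext i j
    rw [mul_diagonal, diagonal_mul]
    rcases eq_or_ne i j with rfl | hij
    · simp [Real.mul_self_sqrt (hpos i).le]
    · simp [hdiag hij, one_apply_ne hij]

lemma rescale_rescale {V : Type*} [Fintype V] [DecidableEq V] {d e : V → ℝ}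
    (hd : ∀ i, d i * e i = 1) (S : Matrix V V ℝ) :
    diagonal d * (diagonal e * S * diagonal e) * diagonal d = S := by
  ext i j
  simp only [mul_diagonal, diagonal_mul]
  linear_combination S i j * e j * d j * hd i + S i j * hd j

lemma model_one_subset {V : Type*} [Fintype V] [DecidableEq V] {C : Matrix V V ℝ}
    (hC : C.PosDef) (hdiag : C.IsDiag) {G H : Digraph V} (h : model C G = model C H) :
    model 1 G ⊆ model 1 H := by
  obtain ⟨d, e, hde, h1, h2⟩ := exists_rescaling hC hdiag
  intro S hS
  have hC1 : (diagonal e * (1 : Matrix V V ℝ) * diagonal e).PosDef := h2 ▸ hC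
  have := rescale_mem_model (d := e) (e := d) (fun i => by rw [mul_comm, hde]) hC1 hS
  rw [h2, h] at this
  have h3 := rescale_mem_model hde (h1 ▸ PosDef.one) this
  rwa [h1, rescale_rescale hde] at h3

lemma apply_eq_zero_of_marginallyIndependent {V : Type*} [Fintype V] [DecidableEq V]
    {C : Matrix V V ℝ} (hC : C.PosDef) (hdiag : C.IsDiag) {G : Digraph V} {k i j : V}
    (h : MarginallyIndependent C G k i j) {S : Matrix V V ℝ} (hS : S ∈ model 1 G) :
    S k i = 0 ∧ S k j = 0 := by
  obtain ⟨d, e, hde, h1, h2⟩ := exists_rescaling hC hdiag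
  have hC1 : (diagonal e * (1 : Matrix V V ℝ) * diagonal e).PosDef := h2 ▸ hC
  have := rescale_mem_model (d := e) (e := d) (fun i => by rw [mul_comm, hde]) hC1 hS
  rw [h2] at this
  have h3 := h _ this
  have he : ∀ i, e i ≠ 0 := fun i hi => by simpa [hi] using hde i
  simpa [mul_diagonal, diagonal_mul, he] using h3

/-! ### Padding by an identity block -/

/-- The matrix of the inclusion of coordinates along `f`. -/
def inclusionMatrix {W V : Type*} [DecidableEq V] (f : W → V) : Matrix V W ℝ :=
  (1 : Matrix V V ℝ).submatrix id f

section Extension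

set_option linter.unusedSectionVars false

variable {W V : Type*} [Fintype W] [DecidableEq W] [Fintype V] [DecidableEq V] (f : W ↪ V)

lemma inclusionMatrix_transpose_mul_self :
    (inclusionMatrix f)ᵀ * inclusionMatrix f = 1 := by
  ext i j
  simp [inclusionMatrix, mul_apply, one_apply]

lemma transpose_mul_mul_inclusionMatrix (A : Matrix V V ℝ) :
    (inclusionMatrix f)ᵀ * A * inclusionMatrix f = A.submatrix f f := by
  ext i j
  simp [inclusionMatrix, mul_apply, one_apply]

/-- The block matrix with block `A` on the range of `f`, and `t` times the identity on the
complement of the range. -/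
def extend (t : ℝ) (A : Matrix W W ℝ) : Matrix V V ℝ :=
  t • (1 - inclusionMatrix f * (inclusionMatrix f)ᵀ) +
    inclusionMatrix f * A * (inclusionMatrix f)ᵀ

lemma extend_mul_inclusionMatrix (t : ℝ) (A : Matrix W W ℝ) :
    extend f t A * inclusionMatrix f = inclusionMatrix f * A := by
  rw [extend, Matrix.add_mul, Matrix.smul_mul, Matrix.sub_mul, Matrix.mul_assoc,
    Matrix.mul_assoc, inclusionMatrix_transpose_mul_self]
  simp

lemma transpose_mul_extend (t : ℝ) (A : Matrix W W ℝ) :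
    (inclusionMatrix f)ᵀ * extend f t A = A * (inclusionMatrix f)ᵀ := by
  rw [extend, Matrix.mul_add, Matrix.mul_smul, Matrix.mul_sub, ← Matrix.mul_assoc,
    ← Matrix.mul_assoc, ← Matrix.mul_assoc, inclusionMatrix_transpose_mul_self]
  simp

lemma extend_submatrix (t : ℝ) (A : Matrix W W ℝ) : (extend f t A).submatrix f f = A := by
  rw [← transpose_mul_mul_inclusionMatrix, transpose_mul_extend, Matrix.mul_assoc,
    inclusionMatrix_transpose_mul_self, Matrix.mul_one]

lemma extend_mul_extend (s t : ℝ) (A B : Matrix W W ℝ) :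
    extend f s A * extend f t B = extend f (s * t) (A * B) := by
  conv_lhs => rw [extend]
  rw [Matrix.add_mul, Matrix.smul_mul, Matrix.sub_mul, Matrix.mul_assoc, Matrix.mul_assoc,
    transpose_mul_extend, extend, extend]
  simp only [Matrix.one_mul, Matrix.mul_assoc, add_sub_cancel_right, smul_smul]

lemma extend_transpose (t : ℝ) (A : Matrix W W ℝ) : (extend f t A)ᵀ = extend f t Aᵀ := by
  simp [extend, Matrix.mul_assoc]

lemma extend_add (s t : ℝ) (A B : Matrix W W ℝ) :
    extend f s A + extend f t B = extend f (s + t) (A + B) := by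
  simp only [extend, Matrix.mul_add, Matrix.add_mul, add_smul]
  abel

lemma extend_one : extend f 1 1 = 1 := by simp [extend]

lemma extend_zero : extend f 0 0 = 0 := by simp [extend]

lemma extend_posDef {S : Matrix W W ℝ} (hS : S.PosDef) : (extend f 1 S).PosDef := by
  have hpsd : (extend f 1 S).PosSemidef := by
    rw [extend, one_smul]
    refine PosSemidef.add ?_ (by simpa using hS.posSemidef.mul_mul_conjTranspose_same _)
    -- This is the orthogonal projection onto the complementary coordinates, hence of the form `P *
    -- Pᴴ`.
    have h1 : (extend f 1 0).PosSemidef := by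
      have h2 : extend f 1 0 = extend f 1 0 * (extend f 1 0)ᴴ := by
        rw [conjTranspose_eq_transpose_of_trivial, extend_transpose, extend_mul_extend]
        simp
      rw [h2]
      exact posSemidef_self_mul_conjTranspose _
    simpa [extend] using h1
  refine hpsd.posDef_iff_isUnit.2 (IsUnit.of_mul_eq_one (extend f 1 S⁻¹) ?_)
  rw [extend_mul_extend, mul_nonsing_inv _ ((isUnit_iff_isUnit_det _).1 hS.isUnit), one_mul,
    extend_one]

lemma extend_apply_of_notMem (t : ℝ) (A : Matrix W W ℝ) {i j : V} (hij : i ≠ j)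
    (h : ¬ ((∃ a, f a = i) ∧ ∃ b, f b = j)) : extend f t A i j = 0 := by
  have h1 : ∀ B : Matrix W W ℝ, (inclusionMatrix f * B * (inclusionMatrix f)ᵀ) i j = 0 := by
    intro B
    simp only [mul_apply, inclusionMatrix, submatrix_apply, transpose_apply, id, one_apply]
    refine Finset.sum_eq_zero fun b _ => ?_
    by_cases hb : j = f b
    · have : ∀ a, i ≠ f a := fun a ha => h ⟨⟨a, ha.symm⟩, b, hb.symm⟩
      simp [this]
    · simp [hb]
  have h2 := h1 1
  rw [Matrix.mul_one] at h2
  simp [extend, h1 A, h2, one_apply_ne hij]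

/-- Models restrict to induced subgraphs. -/
lemma extend_mem_model_iff {G : Digraph V} (hG : ∀ i, G.Adj i i) {S : Matrix W W ℝ} :
    extend f 1 S ∈ model 1 G ↔ S.PosDef ∧ ∃ M : Matrix W W ℝ,
      (∀ a b, ¬ G.Adj (f a) (f b) → M b a = 0) ∧ M * S + S * Mᵀ + 1 = 0 := by
  rw [mem_model_iff PosDef.one]
  constructor
  · rintro ⟨hS, M, hM, h⟩
    refine ⟨?_, M.submatrix f f, fun a b hab => hM _ _ hab, ?_⟩
    · have := hS.submatrix f.injective
      rwa [extend_submatrix] at this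
    · have h1 : (inclusionMatrix f)ᵀ * (M * extend f 1 S + extend f 1 S * Mᵀ + 1) *
          inclusionMatrix f = 0 := by simp [h]
      rw [Matrix.mul_add, Matrix.mul_add, Matrix.add_mul, Matrix.add_mul, Matrix.mul_one,
        inclusionMatrix_transpose_mul_self, ← Matrix.mul_assoc, ← Matrix.mul_assoc,
        transpose_mul_extend, Matrix.mul_assoc, extend_mul_inclusionMatrix, ← Matrix.mul_assoc,
        transpose_mul_mul_inclusionMatrix, Matrix.mul_assoc, Matrix.mul_assoc,
        ← Matrix.mul_assoc _ Mᵀ, transpose_mul_mul_inclusionMatrix] at h1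
      exact h1
  · rintro ⟨hS, M, hM, h⟩
    -- Off the block, drift `-1 / 2` and variance `1` solve the scalar equation `2 * m * s + 1 = 0`.
    refine ⟨extend_posDef f hS, extend f (-1 / 2) M, fun i j hij => ?_, ?_⟩
    · have hne : j ≠ i := fun hji => hij (hji ▸ hG j)
      by_cases hr : (∃ a, f a = j) ∧ ∃ b, f b = i
      · obtain ⟨⟨a, rfl⟩, b, rfl⟩ := hr
        have := congrFun (congrFun (extend_submatrix f (-1 / 2) M) a) b
        rw [submatrix_apply] at this
        rw [this, hM _ _ hij]
      · exact extend_apply_of_notMem f _ _ hne hr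
    · rw [extend_transpose, extend_mul_extend, extend_mul_extend, ← extend_one f, extend_add,
        extend_add, h]
      norm_num [extend_zero]

end Extension

/-! ### Explicit test covariances on two and three nodes -/

/-- The embedding of `Fin 2` with distinct values `a`, `b`. -/
def embPair {V : Type*} {a b : V} (hab : a ≠ b) : Fin 2 ↪ V :=
  ⟨![a, b], by simp [Function.Injective, Fin.forall_fin_two, hab, hab.symm]⟩

/-- The embedding of `Fin 3` with distinct values `a`, `b`, `c`. -/
def embTriple {V : Type*} {a b c : V} (hab : a ≠ b) (hbc : b ≠ c) (hac : a ≠ c) : Fin 3 ↪ V :=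
  ⟨![a, b, c], by
    simp [Function.Injective, Fin.forall_fin_succ, hab, hab.symm, hbc, hbc.symm, hac, hac.symm]⟩

@[simp] lemma embPair_zero {V : Type*} {a b : V} (hab : a ≠ b) : embPair hab 0 = a := rfl

@[simp] lemma embPair_one {V : Type*} {a b : V} (hab : a ≠ b) : embPair hab 1 = b := rfl

@[simp] lemma embTriple_zero {V : Type*} {a b c : V} (hab : a ≠ b) (hbc : b ≠ c) (hac : a ≠ c) :
    embTriple hab hbc hac 0 = a := rfl

@[simp] lemma embTriple_one {V : Type*} {a b c : V} (hab : a ≠ b) (hbc : b ≠ c) (hac : a ≠ c) :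
    embTriple hab hbc hac 1 = b := rfl

@[simp] lemma embTriple_two {V : Type*} {a b c : V} (hab : a ≠ b) (hbc : b ≠ c) (hac : a ≠ c) :
    embTriple hab hbc hac 2 = c := rfl

/-- A covariance matrix of the graph `0 → 1`. -/
def edgeCov : Matrix (Fin 2) (Fin 2) ℝ := !![1, 1; 1, 3]

/-- A covariance matrix of the graph `0 → 1 → 2`. -/
def chainCov : Matrix (Fin 3) (Fin 3) ℝ := !![1, 1, 1; 1, 3, 4; 1, 4, 9]

/-- A covariance matrix of the graph `0 ← 1 → 2`. -/
def forkCov : Matrix (Fin 3) (Fin 3) ℝ := !![3, 1, 2; 1, 1, 1; 2, 1, 3]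

lemma edgeCov_posDef : edgeCov.PosDef := by
  refine .of_dotProduct_mulVec_pos (by ext i j; fin_cases i <;> fin_cases j <;> simp [edgeCov])
    fun x hx => ?_
  by_contra! h
  simp [edgeCov, dotProduct, mulVec, Fin.sum_univ_succ] at h
  -- The form is `(x 0 + x 1)² + 2 (x 1)²`; the two lemmas below complete squares similarly.
  have h1 : x 1 = 0 := by nlinarith [sq_nonneg (x 0 + x 1), sq_nonneg (x 1)]
  have h0 : x 0 = 0 := by rw [h1] at h; nlinarith
  exact hx (funext fun i => by fin_cases i <;> simp [h0, h1])

lemma chainCov_posDef : chainCov.PosDef := by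
  refine .of_dotProduct_mulVec_pos (by ext i j; fin_cases i <;> fin_cases j <;> simp [chainCov])
    fun x hx => ?_
  by_contra! h
  simp [chainCov, dotProduct, mulVec, Fin.sum_univ_succ] at h
  have h2 : x 2 = 0 := by
    nlinarith [sq_nonneg (x 0 + x 1 + x 2), sq_nonneg (x 1 + 3 / 2 * x 2), sq_nonneg (x 2)]
  rw [h2] at h
  have h1 : x 1 = 0 := by nlinarith [sq_nonneg (x 0 + x 1), sq_nonneg (x 1)]
  have h0 : x 0 = 0 := by rw [h1] at h; nlinarith
  exact hx (funext fun i => by fin_cases i <;> simp [h0, h1, h2])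

lemma forkCov_posDef : forkCov.PosDef := by
  refine .of_dotProduct_mulVec_pos (by ext i j; fin_cases i <;> fin_cases j <;> simp [forkCov])
    fun x hx => ?_
  by_contra! h
  simp [forkCov, dotProduct, mulVec, Fin.sum_univ_succ] at h
  have h2 : x 2 = 0 := by
    nlinarith [sq_nonneg (x 0 + x 1 + x 2), sq_nonneg (2 * x 0 + x 2), sq_nonneg (x 2)]
  rw [h2] at h
  have h1 : x 0 = 0 := by nlinarith [sq_nonneg (x 0 + x 1), sq_nonneg (x 0)]
  have h0 : x 1 = 0 := by rw [h1] at h; nlinarith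
  exact hx (funext fun i => by fin_cases i <;> simp [h0, h1, h2])

/-! ### Skeletons and excluded orientations -/

section SmallGraphs

variable {V : Type*} [Fintype V] [DecidableEq V]

lemma extend_edgeCov_mem_model {G : Digraph V} (hG : ∀ i, G.Adj i i) {a b : V} (hab : a ≠ b)
    (h : G.Adj a b) : extend (embPair hab) 1 edgeCov ∈ model 1 G := by
  -- All test covariances come from diagonal drift `-1 / 2` and weight `1` on each edge.
  refine (extend_mem_model_iff _ hG).2 ⟨edgeCov_posDef, !![-1 / 2, 0; 1, -1 / 2], ?_, ?_⟩
  · simp [Fin.forall_fin_two, h, hG]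
  · ext i j
    simp only [Matrix.add_apply, mul_apply, transpose_apply]
    fin_cases i <;> fin_cases j <;> norm_num [edgeCov, Fin.sum_univ_succ]

/-- Adjacent variables are correlated for some covariance matrix in the model. -/
lemma exists_mem_model_apply_ne_zero {G : Digraph V} (hG : ∀ i, G.Adj i i) {a b : V}
    (hab : a ≠ b) (h : G.Adj a b ∨ G.Adj b a) : ∃ S ∈ model 1 G, S a b ≠ 0 := by
  rcases h with h | h
  · refine ⟨_, extend_edgeCov_mem_model hG hab h, ?_⟩
    have := congrFun (congrFun (extend_submatrix (embPair hab) 1 edgeCov) 0) 1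
    rw [submatrix_apply, embPair_zero, embPair_one] at this
    simp only [this]
    simp [edgeCov]
  · refine ⟨_, extend_edgeCov_mem_model hG hab.symm h, ?_⟩
    have := congrFun (congrFun (extend_submatrix (embPair hab.symm) 1 edgeCov) 1) 0
    rw [submatrix_apply, embPair_zero, embPair_one] at this
    simp only [this]
    simp [edgeCov]

/-- The model determines the skeleton. -/
lemma adj_or_adj_of_model_subset {G H : Digraph V} (hG : ∀ i, G.Adj i i) (hH : ∀ i, H.Adj i i)
    (hsub : model 1 G ⊆ model 1 H) {a b : V} (hab : a ≠ b) (h : G.Adj a b) :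
    H.Adj a b ∨ H.Adj b a := by
  obtain ⟨-, M, hM, hL⟩ := (extend_mem_model_iff _ hH).1 (hsub (extend_edgeCov_mem_model hG hab h))
  -- Without an edge the drift is diagonal, and the diagonal equations make the off-diagonal one
  -- fail, since the covariance is `1`.
  by_contra! hcon
  have m1 : M 1 0 = 0 := hM 0 1 hcon.1
  have m2 : M 0 1 = 0 := hM 1 0 hcon.2
  have e00 := congrFun (congrFun hL 0) 0
  have e01 := congrFun (congrFun hL 0) 1
  have e11 := congrFun (congrFun hL 1) 1
  simp [edgeCov, mul_apply, vecMul, dotProduct, Fin.sum_univ_succ, m1, m2] at e00 e01 e11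
  linarith

/-- The alternatives in `hn` confine `H` to the reversed chain, the fork and the collider, in this
order. Each leaves five drift entries for six linear equations, which are inconsistent at
`chainCov`. -/
lemma chain_adj_of_model_subset {G H : Digraph V} (hG : ∀ i, G.Adj i i) (hH : ∀ i, H.Adj i i)
    (hsub : model 1 G ⊆ model 1 H) {a b c : V} (hab : a ≠ b) (hbc : b ≠ c) (hac : a ≠ c)
    (h1 : G.Adj a b) (h2 : G.Adj b c) (n1 : ¬ H.Adj a c) (n2 : ¬ H.Adj c a)
    (hn : ¬ H.Adj a b ∧ ¬ H.Adj b c ∨ ¬ H.Adj a b ∧ ¬ H.Adj c b ∨ ¬ H.Adj b a ∧ ¬ H.Adj b c) :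
    False := by
  have hmem : extend (embTriple hab hbc hac) 1 chainCov ∈ model 1 G := by
    refine (extend_mem_model_iff _ hG).2
      ⟨chainCov_posDef, !![-1 / 2, 0, 0; 1, -1 / 2, 0; 0, 1, -1 / 2], ?_, ?_⟩
    · simp [Fin.forall_fin_succ, h1, h2, hG]
    · ext i j
      simp only [Matrix.add_apply, mul_apply, transpose_apply]
      fin_cases i <;> fin_cases j <;> norm_num [chainCov, Fin.sum_univ_succ]
  obtain ⟨-, M, hM, hL⟩ := (extend_mem_model_iff _ hH).1 (hsub hmem)
  have m1 : M 2 0 = 0 := hM 0 2 n1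
  have m2 : M 0 2 = 0 := hM 2 0 n2
  have e00 := congrFun (congrFun hL 0) 0
  have e01 := congrFun (congrFun hL 0) 1
  have e02 := congrFun (congrFun hL 0) 2
  have e11 := congrFun (congrFun hL 1) 1
  have e12 := congrFun (congrFun hL 1) 2
  have e22 := congrFun (congrFun hL 2) 2
  simp [chainCov, mul_apply, vecMul, dotProduct, Fin.sum_univ_succ, m1, m2] at e00 e01 e02 e11 e12 e22
  rcases hn with ⟨hx, hy⟩ | ⟨hx, hy⟩ | ⟨hx, hy⟩
  · have m3 : M 1 0 = 0 := hM 0 1 hx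
    have m4 : M 2 1 = 0 := hM 1 2 hy
    simp only [m3, m4] at e00 e01 e02 e11 e12 e22
    linarith
  · have m3 : M 1 0 = 0 := hM 0 1 hx
    have m4 : M 1 2 = 0 := hM 2 1 hy
    simp only [m3, m4] at e00 e01 e02 e11 e12 e22
    linarith
  · have m3 : M 0 1 = 0 := hM 1 0 hx
    have m4 : M 2 1 = 0 := hM 1 2 hy
    simp only [m3, m4] at e00 e01 e02 e11 e12 e22
    linarith

/-- At best `H` is a collider at `b` on these nodes. Then `a` and `c` receive no edges and must be
uncorrelated, whereas `forkCov` gives them covariance `2`. -/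
lemma fork_adj_of_model_subset {G H : Digraph V} (hG : ∀ i, G.Adj i i) (hH : ∀ i, H.Adj i i)
    (hsub : model 1 G ⊆ model 1 H) {a b c : V} (hab : a ≠ b) (hbc : b ≠ c) (hac : a ≠ c)
    (h1 : G.Adj b a) (h2 : G.Adj b c) (n1 : ¬ H.Adj a c) (n2 : ¬ H.Adj c a)
    (n3 : ¬ H.Adj b a) (n4 : ¬ H.Adj b c) : False := by
  have hmem : extend (embTriple hab hbc hac) 1 forkCov ∈ model 1 G := by
    refine (extend_mem_model_iff _ hG).2
      ⟨forkCov_posDef, !![-1 / 2, 1, 0; 0, -1 / 2, 0; 0, 1, -1 / 2], ?_, ?_⟩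
    · simp [Fin.forall_fin_succ, h1, h2, hG]
    · ext i j
      simp only [Matrix.add_apply, mul_apply, transpose_apply]
      fin_cases i <;> fin_cases j <;> norm_num [forkCov, Fin.sum_univ_succ]
  obtain ⟨-, M, hM, hL⟩ := (extend_mem_model_iff _ hH).1 (hsub hmem)
  have m1 : M 2 0 = 0 := hM 0 2 n1
  have m2 : M 0 2 = 0 := hM 2 0 n2
  have m3 : M 0 1 = 0 := hM 1 0 n3
  have m4 : M 2 1 = 0 := hM 1 2 n4
  have e00 := congrFun (congrFun hL 0) 0
  have e02 := congrFun (congrFun hL 0) 2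
  have e22 := congrFun (congrFun hL 2) 2
  simp [forkCov, mul_apply, vecMul, dotProduct, Fin.sum_univ_succ, m1, m2, m3, m4] at e00 e02 e22
  linarith

end SmallGraphs

/-! ### Recovering orientations, and paths in trees -/

lemma not_adj_of_mem_dags {V : Type*} {G : Digraph V} (hG : G ∈ dags V) {a b : V} (hab : a ≠ b)
    (h : G.Adj a b) : ¬ G.Adj b a := fun h' =>
  hG.2 a (.tail (.single ⟨hab, h⟩) ⟨hab.symm, h'⟩)

/-- Orientations along a path with three vertices and nonadjacent ends are determined by the
model. -/
lemma adj_of_model_eq_of_path {V : Type*} [Fintype V] [DecidableEq V] {G H : Digraph V}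
    (hG : G ∈ dags V) (hH : H ∈ dags V) (hGH : model 1 G = model 1 H) {a b c : V} (hab : a ≠ b)
    (hbc : b ≠ c) (hac : a ≠ c) (h1 : G.Adj a b) (h2 : G.Adj b c ∨ G.Adj c b)
    (n1 : ¬ G.Adj a c) (n2 : ¬ G.Adj c a) : H.Adj a b := by
  have n1' : ¬ H.Adj a c := fun h =>
    (adj_or_adj_of_model_subset hH.1 hG.1 hGH.ge hac h).elim n1 n2
  have n2' : ¬ H.Adj c a := fun h =>
    (adj_or_adj_of_model_subset hH.1 hG.1 hGH.ge hac.symm h).elim n2 n1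
  by_contra h3
  have h4 := (adj_or_adj_of_model_subset hG.1 hH.1 hGH.le hab h1).resolve_left h3
  have h1' := not_adj_of_mem_dags hG hab h1
  rcases h2 with h2 | h2
  · refine chain_adj_of_model_subset hG.1 hH.1 hGH.le hab hbc hac h1 h2 n1' n2' ?_
    by_cases h5 : H.Adj b c
    · exact .inr (.inl ⟨h3, not_adj_of_mem_dags hH hbc h5⟩)
    · exact .inl ⟨h3, h5⟩
  -- `G` is a collider here, so the reverse inclusion is used: `H` is a chain or a fork, and neither
  -- model fits inside that of a collider.
  · have h2' := not_adj_of_mem_dags hG hbc.symm h2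
    rcases adj_or_adj_of_model_subset hG.1 hH.1 hGH.le hbc.symm h2 with h5 | h5
    · exact chain_adj_of_model_subset hH.1 hG.1 hGH.ge hbc.symm hab.symm hac.symm h5 h4 n2 n1
        (.inr (.inr ⟨h2', h1'⟩))
    · exact fork_adj_of_model_subset hH.1 hG.1 hGH.ge hab hbc hac h4 h5 n1 n2 h1' h2'

/-- In a tree with at least three vertices, every edge is part of a path with three vertices. -/
lemma _root_.SimpleGraph.IsTree.exists_adj_and_not_adj {V : Type*} [Fintype V]
    {G : SimpleGraph V} (hG : G.IsTree) (hV : 3 ≤ Fintype.card V) {i j : V} (hij : G.Adj i j) :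
    ∃ k, k ≠ i ∧ k ≠ j ∧ (G.Adj k i ∧ ¬ G.Adj k j ∨ G.Adj k j ∧ ¬ G.Adj k i) := by
  classical
  have htri : ∀ k, G.Adj k i → ¬ G.Adj k j := by
    intro k hki hkj
    have hc : (SimpleGraph.Walk.cons hki (.cons hij (.cons hkj.symm .nil))).IsCycle := by
      rw [SimpleGraph.Walk.isCycle_def]
      simp [SimpleGraph.Walk.isTrail_def, hki.ne, hij.ne, hkj.ne, hki.ne', hkj.ne']
    exact hG.isAcyclic _ hc
  -- With triangles excluded, failure means that no edge leaves `{i, j}`, and connectedness forces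
  -- `V` to have at most two elements.
  by_contra! hcon
  have hcl : ∀ k, G.Reachable i k → k = i ∨ k = j := by
    rintro k ⟨p⟩
    have : ∀ {u v : V} (p : G.Walk u v), (u = i ∨ u = j) → (v = i ∨ v = j) := by
      intro u v p
      induction p with
      | nil => exact id
      | @cons u v w h p ih =>
        intro hu
        refine ih ?_
        by_contra! hv
        obtain ⟨c1, c2⟩ := hcon v hv.1 hv.2
        rcases hu with rfl | rfl
        · exact htri v h.symm (c1 h.symm)
        · exact htri v (c2 h.symm) h.symm
    exact this p (.inl rfl)
  have hle : (Finset.univ : Finset V) ⊆ {i, j} := fun k _ => by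
    simpa using hcl k (hG.connected.preconnected i k)
  have := Finset.card_le_card hle
  have h2 : ({i, j} : Finset V).card ≤ 2 := Finset.card_le_two
  rw [Finset.card_univ] at this
  omega

end LyapunovModel

theorem mainTheorem9 {V : Type*} [Fintype V] [DecidableEq V] (hV : 3 ≤ Fintype.card V)
    (C : Matrix V V ℝ) (hC : C.PosDef) (hdiag : C.IsDiag)
    (T : Digraph V) (hT : LyapunovModel.IsPolytree T) :
    LyapunovModel.StructurallyIdentifiable C (LyapunovModel.dags V) T ∧
      ∀ i j : V, ¬ LyapunovModel.IsSuperCovered C T i j := by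
  open LyapunovModel in
  obtain ⟨hdag, htree⟩ := hT
  have hskel : ∀ a b, T.toSimpleGraphInclusive.Adj a b ↔ a ≠ b ∧ (T.Adj a b ∨ T.Adj b a) :=
    fun a b => Iff.rfl
  refine ⟨⟨hdag, T, ⟨hdag, rfl⟩, ?_⟩, ?_⟩
  · rintro H ⟨hH, hTH⟩
    have hmod : model 1 T = model 1 H :=
      (model_one_subset hC hdiag hTH).antisymm (model_one_subset hC hdiag hTH.symm)
    have key : ∀ a b, a ≠ b → T.Adj a b → H.Adj a b := by
      intro a b hab h
      obtain ⟨k, hka, hkb, hk⟩ := htree.exists_adj_and_not_adj hV ((hskel a b).2 ⟨hab, .inl h⟩)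
      simp only [hskel, not_and, not_or] at hk
      rcases hk with ⟨⟨-, h1⟩, h2⟩ | ⟨⟨-, h1⟩, h2⟩
      · obtain ⟨n1, n2⟩ := h2 hkb
        -- The path is now `b - a - k`, with `a → b` pointing away from its middle. If `H` reversed
        -- this edge, it would point to the middle in `H`, and the path lemma with `T` and `H`
        -- exchanged would put `b → a` in `T`.
        by_contra hcon
        have h3 := (adj_or_adj_of_model_subset hdag.1 hH.1 hmod.le hab h).resolve_left hcon
        have hTn := not_adj_of_mem_dags hdag hab h
        have skelH : ∀ {u v}, u ≠ v → H.Adj u v → T.Adj u v ∨ T.Adj v u := fun huv h' =>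
          adj_or_adj_of_model_subset hH.1 hdag.1 hmod.ge huv h'
        refine hTn (adj_of_model_eq_of_path hH hdag hmod.symm hab.symm hka.symm hkb.symm h3
          ?_ (fun h' => (skelH hkb.symm h').elim n2 n1) fun h' => (skelH hkb h').elim n1 n2)
        rcases h1 with h1 | h1
        · exact (adj_or_adj_of_model_subset hdag.1 hH.1 hmod.le hka h1).symm
        · exact adj_or_adj_of_model_subset hdag.1 hH.1 hmod.le hka.symm h1
      · obtain ⟨n1, n2⟩ := h2 hka
        exact adj_of_model_eq_of_path hdag hH hmod hab hkb.symm hka.symm h h1.symm n2 n1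
    ext a b
    rcases eq_or_ne a b with rfl | hab
    · exact iff_of_true (hH.1 a) (hdag.1 a)
    · refine ⟨fun h => ?_, key a b hab⟩
      exact (adj_or_adj_of_model_subset hH.1 hdag.1 hmod.ge hab h).resolve_right
        fun h' => not_adj_of_mem_dags hH hab h (key b a hab.symm h')
  · intro i j hsc
    obtain ⟨k, hki, hkj, hk⟩ :=
      htree.exists_adj_and_not_adj hV ((hskel i j).2 ⟨hsc.ne, .inl hsc.adj⟩)
    have hnb : ∀ l, k ∈ neighbors T l → T.toSimpleGraphInclusive.Adj k l := by
      rintro l (⟨hne, h⟩ | ⟨hne, h⟩)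
      · exact (hskel k l).2 ⟨hne, .inl h⟩
      · exact (hskel k l).2 ⟨hne, .inr h⟩
    -- Only the third condition is needed: `k` is not a common neighbor, and its edge to `i` or `j`
    -- rules out independence.
    rcases hsc.others k hki hkj with ⟨h1, h2⟩ | h
    · rcases hk with ⟨-, h3⟩ | ⟨-, h3⟩
      exacts [h3 (hnb _ h2), h3 (hnb _ h1)]
    · rcases hk with ⟨⟨hne, h3⟩, -⟩ | ⟨⟨hne, h3⟩, -⟩
      · obtain ⟨S, hS, h0⟩ := exists_mem_model_apply_ne_zero hdag.1 hne h3
        exact h0 (apply_eq_zero_of_marginallyIndependent hC hdiag h hS).1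
      · obtain ⟨S, hS, h0⟩ := exists_mem_model_apply_ne_zero hdag.1 hne h3
        exact h0 (apply_eq_zero_of_marginallyIndependent hC hdiag h hS).2
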